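/- **GOM bounded smoothness of BGLMs.** Let $G$ be a finite directed acyclic graph on a node set $\boldsymbol X\cup\{Y\}$ of $\{0,1\}$-valued variables, where the reward node $Y\notin\boldsymbol X$ has no outgoing edges and a special node $X_1\in\boldsymbol X$ is a parent of every other node and always takes the value $1$. Write $\boldsymbol{Pa}(X)$ for the set of parents of $X$. A (Markovian) binary generalized linear model (BGLM) on $G$ consists of non-decreasing functions $f_X$ ($X\neq X_1$), a random noise vector $\boldsymbol\varepsilon=(\varepsilon_X)$ with zero-mean sub-Gaussian entries, and a set $\Theta$ of weight vectors $\boldsymbol\theta=(\boldsymbol\theta_X)_X$ with $\boldsymbol\theta_X\in[0,1]^{\boldsymbol{Pa}(X)}$. Given $\boldsymbol\varepsilon$, each $X\ne X_1$ equals $1$ with probability $$P(X=1\mid \boldsymbol{Pa}(X)=\boldsymbol{pa}(X))=f_X(\boldsymbol\theta_X\cdot\boldsymbol{pa}(X))+\varepsilon_X ,$$ where for every $\boldsymbol\theta\in\Theta$ and all parent values with $X_1=1$ the right-hand side is almost surely in $[0,1]$. Assume that each $f_X$ ($X\ne X_1$) is differentiable with derivative at most $L^{(1)}_{f_X}$ on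 $[0,|\boldsymbol{Pa}(X)|]$. For $\boldsymbol S\subseteq\boldsymbol X$ let $\sigma(\boldsymbol S,\boldsymbol\theta)=\mathbb E[Y\mid do(\boldsymbol S)]$ be the expected value of $Y$ under $\boldsymbol\theta$ when all nodes of $\boldsymbol S$ are forced to $1$. Let the thresholds $\boldsymbol\gamma=(\gamma_X)$ be independent, uniform on $[0,1]$, and independent of $\boldsymbol\varepsilon$. In the threshold propagation from $\boldsymbol S$ under $\boldsymbol\theta$, the nodes of $\boldsymbol S\cup\{X_1\}$ are activated, and every other node $X$, in topological order, is activated if and only if $f_X(\boldsymbol\theta_X\cdot\boldsymbol{pa}(X))+\varepsilon_X\ge\gamma_X$, where $\boldsymbol{pa}(X)$ is the $0/1$ vector of the activations of its parents. Then for all $\boldsymbol\theta^1,\boldsymbol\theta^2\in\Theta$ and every $\boldsymbol S\subseteq\boldsymbol X$, $$\left|\sigma(\boldsymbol S,\boldsymbol\theta^1)-\sigma(\boldsymbol S,\boldsymbol\theta^2)\right|\le\mathbb E_{\boldsymbol\varepsilon,\boldsymbol\gamma}\Big[\sum_{X\in\boldsymbol X_{\boldsymbol S,Y}}\left|\boldsymbol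 V_X^{\intercal}(\boldsymbol\theta^1_X-\boldsymbol\theta^2_X)\right|L^{(1)}_{f_X}\Big],$$ where $\boldsymbol X_{\boldsymbol S,Y}$ is the set of nodes on directed paths from $\boldsymbol S\cup\{X_1\}$ to $Y$, excluding the nodes of $\boldsymbol S\cup\{X_1\}$ (the always-active node $X_1$ counts as intervened), and $\boldsymbol V_X$ is the $0/1$ vector of the activations of the parents of $X$ in the propagation from $\boldsymbol S$ under $\boldsymbol\theta^2$. -/

import Mathlib

open MeasureTheory ProbabilityTheory Set

/-- A Markovian causal graph on the finite set `V` of observed (binary) variables: a directed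
acyclic graph with a reward node `Y` without outgoing edges and a special node `X₁`
(the variable that always takes the value `1`) which is a parent of every other node. -/
structure CausalGraph (V : Type*) where
  /-- `edge Z X`: there is an edge from `Z` to `X`, i.e. `Z` is a parent of `X`. -/
  edge : V → V → Prop
  /-- the special node `X₁`, always equal to `1` -/
  X₁ : V
  /-- the reward node -/
  Y : V
  acyclic : ∀ X, ¬ Relation.TransGen edge X X
  Y_no_out : ∀ X, ¬ edge Y X
  X₁_ne_Y : X₁ ≠ Y
  X₁_parent : ∀ X, X ≠ X₁ → edge X₁ X

namespace CausalGraph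

variable {V : Type*} [Fintype V]

open Classical in
/-- The set of parents of a node. -/
noncomputable def Pa (G : CausalGraph V) (X : V) : Finset V :=
  Finset.univ.filter fun Z => G.edge Z X

theorem edge_of_mem_Pa (G : CausalGraph V) {X Z : V} (h : Z ∈ G.Pa X) : G.edge Z X := by
  simpa [Pa] using h

theorem wellFounded_edge (G : CausalGraph V) : WellFounded G.edge := by
  have : Std.Irrefl (Relation.TransGen G.edge) := ⟨G.acyclic⟩
  have h : WellFounded (Relation.TransGen G.edge) := Finite.wellFounded_of_trans_of_irrefl _
  exact Subrelation.wf (fun h => Relation.TransGen.single h) h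

/-- Weight vectors: one real weight for every edge `(Z, X)`; `θ X` is the vector of weights
of the edges from the parents of `X` into `X`. -/
abbrev Weights (G : CausalGraph V) : Type _ := (X : V) → G.Pa X → ℝ

open Classical in
/-- The nodes lying on directed paths from the set `A` to the reward node `Y`
(end points included), excluding the nodes of `A` themselves. -/
noncomputable def pathNodes (G : CausalGraph V) (A : Finset V) : Finset V :=
  Finset.univ.filter fun X => X ∉ A ∧
    ∃ s ∈ A, Relation.ReflTransGen G.edge s X ∧ Relation.ReflTransGen G.edge X G.Y

/-- The `0/1` vector of values of the parents of `X`, for given values `x` of the nodes. -/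
def parentVec (G : CausalGraph V) (x : V → Bool) (X : V) : G.Pa X → ℝ :=
  fun Z => if x Z then 1 else 0

end CausalGraph

/-- A (Markovian) binary generalized linear model on `V`, without its weight vector. Given the
noises `ε`, a node `X ≠ X₁` whose parents have the values `pa` is `1` with probability
`f X (θ X ⬝ pa) + ε X`. -/
structure BGLM (V : Type*) [Fintype V] extends CausalGraph V where
  /-- the link functions -/
  f : V → ℝ → ℝ
  /-- the joint law of the noises `ε = (ε X)` -/
  noise : Measure (V → ℝ)
  /-- the feasible domain of the weight vectors -/
  Θ : Set toCausalGraph.Weights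
  noise_prob : IsProbabilityMeasure noise
  /-- Link functions are non-decreasing, on the range `[0, |Pa(X)|]` of their arguments. -/
  f_mono : ∀ X, X ≠ X₁ → MonotoneOn (f X) (Icc 0 ((toCausalGraph.Pa X).card : ℝ))
  noise_mean : ∀ X, X ≠ X₁ → ∫ ε, ε X ∂noise = 0
  noise_subgaussian : ∀ X, X ≠ X₁ → ∃ c, HasSubgaussianMGF (fun ε : V → ℝ => ε X) c noise
  Θ_unit : ∀ θ ∈ Θ, ∀ X Z, θ X Z ∈ Icc (0 : ℝ) 1
  /-- The noises keep the activation probabilities in `[0, 1]`. -/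
  prob_mem : ∀ θ ∈ Θ, ∀ X, X ≠ X₁ → ∀ x : V → Bool, x X₁ = true →
    ∀ᵐ ε ∂noise, f X (toCausalGraph.parentVec x X ⬝ᵥ θ X) + ε X ∈ Icc (0 : ℝ) 1

namespace BGLM

variable {V : Type*} [Fintype V] [DecidableEq V]

/-- `P(X = 1 | Pa(X) = pa(X))` under weights `θ` and noises `ε`, where the parents of `X`
take their values from `x`. -/
noncomputable def prob (M : BGLM V) (θ : M.Weights) (ε : V → ℝ) (x : V → Bool) (X : V) : ℝ :=
  M.f X (M.parentVec x X ⬝ᵥ θ X) + ε X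

/-- The probability, given the noises `ε`, that the nodes take the values `x` under the
intervention `do(S)` setting all nodes of `S` to `1` (truncated factorization); the node `X₁` is
always `1`. -/
noncomputable def doProb (M : BGLM V) (S : Finset V) (θ : M.Weights) (ε : V → ℝ)
    (x : V → Bool) : ℝ :=
  ∏ X, if X ∈ S ∨ X = M.X₁ then (if x X then 1 else 0)
    else (if x X then M.prob θ ε x X else 1 - M.prob θ ε x X)

/-- The expected reward `σ(S, θ) = E[Y | do(S)]` under the weights `θ`. -/
noncomputable def σ (M : BGLM V) (S : Finset V) (θ : M.Weights) : ℝ :=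
  ∫ ε, ∑ x : V → Bool, M.doProb S θ ε x * (if x M.Y then 1 else 0) ∂M.noise

open Classical in
/-- The threshold propagation under `do(S)` with weights `θ`, noises `ε` and thresholds `γ`:
the nodes of `S` and `X₁` are activated; any other node `X` is activated if and only if
`f X (θ X ⬝ pa) + ε X ≥ γ X`, where `pa` is the vector of activations of its parents. -/
noncomputable def propagate (M : BGLM V) (S : Finset V) (θ : M.Weights) (ε γ : V → ℝ) :
    V → Bool :=
  M.wellFounded_edge.fix fun X act =>
    decide (X ∈ S ∨ X = M.X₁ ∨
      γ X ≤ M.f X ((fun Z : M.Pa X =>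
        if act Z (M.edge_of_mem_Pa Z.2) then (1 : ℝ) else 0) ⬝ᵥ θ X) + ε X)

theorem propagate_iff (M : BGLM V) (S : Finset V) (θ : M.Weights) (ε γ : V → ℝ) (X : V) :
    M.propagate S θ ε γ X = true ↔
      X ∈ S ∨ X = M.X₁ ∨ γ X ≤ M.prob θ ε (M.propagate S θ ε γ) X := by
  rw [propagate, WellFounded.fix_eq, decide_eq_true_iff]
  rfl

/-- The law of the thresholds: independent and uniform on `[0, 1]`. -/
noncomputable def thresholds (V : Type*) [Fintype V] : Measure (V → ℝ) :=
  Measure.pi fun _ => volume.restrict (Icc 0 1)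

end BGLM

namespace CausalGraph

variable {V : Type*} [Fintype V]

/-! Couple the two models through the same noises and thresholds. By independence of the thresholds,
`σ` is the probability that the propagation activates `Y`, so the difference is at most the
probability that the two propagations disagree at `Y`. If they do, some ancestor `X` of `Y` is a
first node of disagreement: its parents agree, and `γ X` lies between the two activation
probabilities computed from the common parent values (`exists_mem_uIoc_of_propagate_ne`). Take a
union bound over such `X`.

For fixed `X`, intervening on `X` as well makes the propagation independent of `γ X` and, by
acyclicity, leaves the parents of `X` unchanged. The probability of landing in the random interval
is therefore at most its expected length (`thresholds_real_mem_uIoc_le`), which the derivative bound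
controls. -/

theorem mem_Pa (G : CausalGraph V) {X Z : V} : Z ∈ G.Pa X ↔ G.edge Z X := by
  simp [Pa]

theorem parentVec_congr (G : CausalGraph V) {x y : V → Bool} {X : V}
    (h : ∀ Z, G.edge Z X → x Z = y Z) : G.parentVec x X = G.parentVec y X := by
  funext Z
  simp only [parentVec, h Z (G.edge_of_mem_Pa Z.2)]

theorem parentVec_mem_Icc (G : CausalGraph V) (x : V → Bool) (X : V) (Z : G.Pa X) :
    G.parentVec x X Z ∈ Icc (0 : ℝ) 1 := by
  unfold parentVec
  split_ifs <;> simp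

theorem parentVec_dotProduct_mem_Icc (G : CausalGraph V) (x : V → Bool) (X : V)
    {w : G.Pa X → ℝ} (hw : ∀ Z, w Z ∈ Icc (0 : ℝ) 1) :
    G.parentVec x X ⬝ᵥ w ∈ Icc (0 : ℝ) ((G.Pa X).card : ℝ) := by
  have hp := G.parentVec_mem_Icc x X
  refine ⟨Finset.sum_nonneg fun Z _ => mul_nonneg (hp Z).1 (hw Z).1, ?_⟩
  calc G.parentVec x X ⬝ᵥ w ≤ ∑ _Z : G.Pa X, (1 : ℝ) :=
        Finset.sum_le_sum fun Z _ => mul_le_one₀ (hp Z).2 (hw Z).1 (hw Z).2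
    _ = (G.Pa X).card := by simp

/-- Since `X₁` is a parent of every other node, an ancestor of `Y` is automatically on a path from
the intervened nodes. -/
theorem mem_pathNodes_of_reflTransGen [DecidableEq V] (G : CausalGraph V) {S : Finset V} {X : V}
    (hXS : X ∉ S) (hX : X ≠ G.X₁) (h : Relation.ReflTransGen G.edge X G.Y) :
    X ∈ G.pathNodes (insert G.X₁ S) := by
  simp only [pathNodes, Finset.mem_filter, Finset.mem_univ, true_and, Finset.mem_insert, not_or]
  exact ⟨⟨hX, hXS⟩, G.X₁, Or.inl rfl, .single (G.X₁_parent X hX), h⟩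

theorem not_mem_of_mem_pathNodes (G : CausalGraph V) {A : Finset V} {X : V}
    (h : X ∈ G.pathNodes A) : X ∉ A := by
  simp only [pathNodes, Finset.mem_filter] at h
  exact h.2.1

/-- If two valuations differ at `Y`, some ancestor of `Y` is a first node at which they differ. -/
theorem exists_first_ne (G : CausalGraph V) {x y : V → Bool} {X : V} (h : x X ≠ y X) :
    ∃ Z, Relation.ReflTransGen G.edge Z X ∧ x Z ≠ y Z ∧ ∀ W, G.edge W Z → x W = y W := by
  induction X using G.wellFounded_edge.induction with
  | _ X ih =>
    by_cases hX : ∀ W, G.edge W X → x W = y W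
    · exact ⟨X, .refl, h, hX⟩
    · push Not at hX
      obtain ⟨W, hW, hne⟩ := hX
      obtain ⟨Z, hZ, h1, h2⟩ := ih W hW hne
      exact ⟨Z, hZ.tail hW, h1, h2⟩

end CausalGraph

namespace BGLM

variable {V : Type*} [Fintype V]

instance : IsProbabilityMeasure (volume.restrict (Icc (0 : ℝ) 1)) :=
  ⟨by simp⟩

instance : IsProbabilityMeasure (thresholds V) := by
  unfold thresholds; infer_instance

instance (M : BGLM V) : IsProbabilityMeasure M.noise := M.noise_prob

theorem prob_congr (M : BGLM V) (θ : M.Weights) (ε : V → ℝ) {x y : V → Bool} {X : V}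
    (h : ∀ Z, M.edge Z X → x Z = y Z) : M.prob θ ε x X = M.prob θ ε y X := by
  unfold prob
  rw [M.parentVec_congr h]

theorem thresholds_real_pi (s : V → Set ℝ) : (thresholds V).real (Set.univ.pi s) =
    ∏ X, (volume.restrict (Icc (0 : ℝ) 1)).real (s X) := by
  simp only [thresholds, Measure.real, Measure.pi_pi, ENNReal.toReal_prod]

/-- Mean value inequality; monotonicity supplies the other side, so an upper bound on the derivative
suffices. -/
theorem abs_link_sub_le (M : BGLM V) {L : V → ℝ} {X : V} (hX : X ≠ M.X₁)
    (hf : ∀ t ∈ Icc (0 : ℝ) ((M.Pa X).card : ℝ),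
      DifferentiableAt ℝ (M.f X) t ∧ deriv (M.f X) t ≤ L X)
    {s t : ℝ} (hs : s ∈ Icc (0 : ℝ) ((M.Pa X).card : ℝ))
    (ht : t ∈ Icc (0 : ℝ) ((M.Pa X).card : ℝ)) : |M.f X s - M.f X t| ≤ |s - t| * L X := by
  wlog hst : s ≤ t generalizing s t
  · rw [abs_sub_comm, abs_sub_comm s]
    exact this ht hs (le_of_not_ge hst)
  have hmono := M.f_mono X hX hs ht hst
  have := (convex_Icc (0 : ℝ) ((M.Pa X).card : ℝ)).image_sub_le_mul_sub_of_deriv_le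
    (fun u hu => (hf u hu).1.continuousAt.continuousWithinAt)
    (fun u hu => (hf u (interior_subset hu)).1.differentiableWithinAt)
    (fun u hu => (hf u (interior_subset hu)).2) s hs t ht hst
  rw [abs_sub_comm, abs_sub_comm s, abs_of_nonneg (sub_nonneg.2 hmono),
    abs_of_nonneg (sub_nonneg.2 hst)]
  linarith

theorem abs_prob_sub_le (M : BGLM V) {L : V → ℝ} {X : V} (hX : X ≠ M.X₁)
    (hf : ∀ t ∈ Icc (0 : ℝ) ((M.Pa X).card : ℝ),
      DifferentiableAt ℝ (M.f X) t ∧ deriv (M.f X) t ≤ L X)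
    {θ₁ θ₂ : M.Weights} (hθ₁ : θ₁ ∈ M.Θ) (hθ₂ : θ₂ ∈ M.Θ) (ε : V → ℝ) (x : V → Bool) :
    |M.prob θ₁ ε x X - M.prob θ₂ ε x X| ≤ |M.parentVec x X ⬝ᵥ (θ₁ X - θ₂ X)| * L X := by
  rw [prob, prob, add_sub_add_right_eq_sub, dotProduct_sub]
  exact M.abs_link_sub_le hX hf
    (M.parentVec_dotProduct_mem_Icc x X (M.Θ_unit θ₁ hθ₁ X))
    (M.parentVec_dotProduct_mem_Icc x X (M.Θ_unit θ₂ hθ₂ X))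

/-! ### The threshold propagation and its measurability -/

variable [DecidableEq V]

/-- By acyclicity the local activation rules have a unique solution; each rule constrains only its
own threshold once `x` is fixed. -/
theorem propagate_eq_iff (M : BGLM V) (S : Finset V) (θ : M.Weights) (ε γ : V → ℝ)
    (x : V → Bool) : M.propagate S θ ε γ = x ↔
      ∀ X, (x X = true ↔ X ∈ S ∨ X = M.X₁ ∨ γ X ≤ M.prob θ ε x X) := by
  refine ⟨fun h X => by subst h; exact M.propagate_iff S θ ε γ X, fun h => funext fun X => ?_⟩
  induction X using M.wellFounded_edge.induction with
  | _ X ih => rw [Bool.eq_iff_iff, M.propagate_iff, h X, M.prob_congr θ ε ih]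

/-- Intervening on `X` does not change the activations of nodes that are not descendants of `X`. -/
theorem propagate_insert_of_not_reflTransGen (M : BGLM V) (S : Finset V) (θ : M.Weights)
    (ε γ : V → ℝ) (X : V) {Z : V} (hZ : ¬ Relation.ReflTransGen M.edge X Z) :
    M.propagate (insert X S) θ ε γ Z = M.propagate S θ ε γ Z := by
  induction Z using M.wellFounded_edge.induction with
  | _ Z ih =>
    have hne : Z ≠ X := fun h => hZ (h ▸ .refl)
    rw [Bool.eq_iff_iff, M.propagate_iff, M.propagate_iff, Finset.mem_insert,
      M.prob_congr θ ε fun W hW => ih W hW fun h => hZ (h.tail hW)]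
    simp [hne]

theorem propagate_insert_of_edge (M : BGLM V) (S : Finset V) (θ : M.Weights)
    (ε γ : V → ℝ) {X Z : V} (hZ : M.edge Z X) :
    M.propagate (insert X S) θ ε γ Z = M.propagate S θ ε γ Z :=
  M.propagate_insert_of_not_reflTransGen S θ ε γ X fun h =>
    M.acyclic X (Relation.TransGen.tail' h hZ)

theorem measurable_propagate (M : BGLM V) (S : Finset V) (θ : M.Weights) :
    Measurable fun p : (V → ℝ) × (V → ℝ) => M.propagate S θ p.1 p.2 := by
  refine measurable_pi_iff.2 fun X => ?_
  induction X using M.wellFounded_edge.induction with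
  | _ X ih =>
    refine measurable_to_bool ?_
    have hpre : (fun p : (V → ℝ) × (V → ℝ) => M.propagate S θ p.1 p.2 X) ⁻¹' {true} =
        {p | X ∈ S ∨ X = M.X₁ ∨ p.2 X ≤ M.prob θ p.1 (M.propagate S θ p.1 p.2) X} := by
      ext p; exact M.propagate_iff S θ p.1 p.2 X
    rw [hpre]
    have hpar : Measurable fun p : (V → ℝ) × (V → ℝ) =>
        fun Z : M.Pa X => M.propagate S θ p.1 p.2 Z :=
      measurable_pi_iff.2 fun Z => ih Z (M.edge_of_mem_Pa Z.2)
    -- The parents take finitely many joint values, so measurability of `f X` is not needed.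
    have hlink : Measurable fun p : (V → ℝ) × (V → ℝ) =>
        M.f X (M.parentVec (M.propagate S θ p.1 p.2) X ⬝ᵥ θ X) :=
      (Measurable.of_discrete (f := fun v : M.Pa X → Bool =>
        M.f X ((fun Z => if v Z then (1 : ℝ) else 0) ⬝ᵥ θ X))).comp hpar
    have hle : MeasurableSet {p : (V → ℝ) × (V → ℝ) |
        p.2 X ≤ M.prob θ p.1 (M.propagate S θ p.1 p.2) X} :=
      measurableSet_le (by fun_prop) (hlink.add (by fun_prop))
    exact (MeasurableSet.const _).union ((MeasurableSet.const _).union hle)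

theorem measurable_propagate_right (M : BGLM V) (S : Finset V) (θ : M.Weights) (ε : V → ℝ) :
    Measurable fun γ : V → ℝ => M.propagate S θ ε γ :=
  (M.measurable_propagate S θ).comp measurable_prodMk_left

/-! ### Law of the propagation and the truncated factorization -/

/-- The thresholds at `X` that lead to the value `x X` when the parents have the values `x`. -/
def box (M : BGLM V) (S : Finset V) (θ : M.Weights) (ε : V → ℝ) (x : V → Bool) (X : V) : Set ℝ :=
  {t | x X = true ↔ X ∈ S ∨ X = M.X₁ ∨ t ≤ M.prob θ ε x X}

theorem setOf_propagate_eq (M : BGLM V) (S : Finset V) (θ : M.Weights) (ε : V → ℝ)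
    (x : V → Bool) : {γ | M.propagate S θ ε γ = x} = Set.univ.pi (M.box S θ ε x) := by
  ext γ
  simp [propagate_eq_iff, box]

theorem real_Iic_of_mem_Icc {a : ℝ} (ha : a ∈ Icc (0 : ℝ) 1) :
    (volume.restrict (Icc (0 : ℝ) 1)).real (Iic a) = a := by
  have : Iic a ∩ Icc 0 1 = Icc 0 a := by
    ext t; simp only [mem_inter_iff, mem_Iic, mem_Icc]
    exact ⟨fun h => ⟨h.2.1, h.1⟩, fun h => ⟨h.2, h.1, h.2.trans ha.2⟩⟩
  rw [measureReal_restrict_apply measurableSet_Iic, this]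
  simp [ha.1]

theorem thresholds_real_propagate_eq (M : BGLM V) (S : Finset V) (θ : M.Weights) {ε : V → ℝ}
    (hε : ∀ X, X ≠ M.X₁ → ∀ x : V → Bool, x M.X₁ = true → M.prob θ ε x X ∈ Icc (0 : ℝ) 1)
    (x : V → Bool) :
    (thresholds V).real {γ | M.propagate S θ ε γ = x} = M.doProb S θ ε x := by
  rw [setOf_propagate_eq, thresholds_real_pi, doProb]
  by_cases hx : x M.X₁ = true
  · refine Finset.prod_congr rfl fun X _ => ?_
    by_cases hX : X ∈ S ∨ X = M.X₁
    · have hX' : ∀ q : Prop, (X ∈ S ∨ X = M.X₁ ∨ q) ↔ True := by tauto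
      cases h : x X <;> simp [box, hX, hX', h]
    · have hq := hε X (fun h => hX (Or.inr h)) x hx
      have hX' : ∀ q : Prop, (X ∈ S ∨ X = M.X₁ ∨ q) ↔ q := by tauto
      rw [if_neg hX]
      cases h : x X
      · have hbox : M.box S θ ε x X = (Iic (M.prob θ ε x X))ᶜ := by
          ext t; simp [box, hX', h]
        rw [hbox, probReal_compl_eq_one_sub measurableSet_Iic, real_Iic_of_mem_Icc hq]
        simp
      · have hbox : M.box S θ ε x X = Iic (M.prob θ ε x X) := by
          ext t; simp [box, hX', h]
        rw [hbox, real_Iic_of_mem_Icc hq]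
        simp
  -- If `x` gives `X₁` the value `0`, the other factors need not be probabilities, but the factor at
  -- `X₁` vanishes on both sides.
  · rw [Finset.prod_eq_zero (Finset.mem_univ M.X₁), Finset.prod_eq_zero (Finset.mem_univ M.X₁)]
    · simp [hx]
    · simp [box, hx]

theorem integral_comp_propagate (M : BGLM V) (S : Finset V) (θ : M.Weights) (ε : V → ℝ)
    (h : (V → Bool) → ℝ) : ∫ γ, h (M.propagate S θ ε γ) ∂thresholds V =
      ∑ x, (thresholds V).real {γ | M.propagate S θ ε γ = x} * h x := by
  have hm := M.measurable_propagate_right S θ ε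
  have := Measure.isProbabilityMeasure_map (μ := thresholds V) hm.aemeasurable
  rw [← integral_map hm.aemeasurable Measurable.of_discrete.aestronglyMeasurable,
    integral_fintype .of_finite]
  refine Finset.sum_congr rfl fun x _ => ?_
  rw [map_measureReal_apply hm (measurableSet_singleton x), smul_eq_mul]
  rfl

theorem ae_prob_mem (M : BGLM V) {θ : M.Weights} (hθ : θ ∈ M.Θ) : ∀ᵐ ε ∂M.noise,
    ∀ X, X ≠ M.X₁ → ∀ x : V → Bool, x M.X₁ = true → M.prob θ ε x X ∈ Icc (0 : ℝ) 1 := by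
  refine ae_all_iff.2 fun X => ?_
  by_cases hX : X = M.X₁
  · exact .of_forall fun ε h => absurd hX h
  have : ∀ᵐ ε ∂M.noise, ∀ x : V → Bool, x M.X₁ = true → M.prob θ ε x X ∈ Icc (0 : ℝ) 1 := by
    refine ae_all_iff.2 fun x => ?_
    by_cases hx : x M.X₁ = true
    · filter_upwards [M.prob_mem θ hθ X hX x hx] with ε h _ using h
    · exact .of_forall fun ε h => absurd h hx
  filter_upwards [this] with ε h _ using h

theorem σ_eq_integral_propagate (M : BGLM V) (S : Finset V) {θ : M.Weights} (hθ : θ ∈ M.Θ) :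
    M.σ S θ = ∫ ε, ∫ γ, (if M.propagate S θ ε γ M.Y then 1 else 0) ∂thresholds V ∂M.noise := by
  refine integral_congr_ae ?_
  filter_upwards [M.ae_prob_mem hθ] with ε hε
  rw [M.integral_comp_propagate S θ ε fun x => if x M.Y then 1 else 0]
  exact Finset.sum_congr rfl fun x _ => by rw [M.thresholds_real_propagate_eq S θ hε]

theorem integrable_comp_propagate (M : BGLM V) (S : Finset V) (θ : M.Weights)
    (h : (V → Bool) → ℝ) : Integrable (fun p : (V → ℝ) × (V → ℝ) => h (M.propagate S θ p.1 p.2))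
      (M.noise.prod (thresholds V)) := by
  have hm := M.measurable_propagate S θ
  have := Measure.isProbabilityMeasure_map (μ := M.noise.prod (thresholds V)) hm.aemeasurable
  exact (Integrable.of_finite (f := h)).comp_measurable hm

/-! ### Coupling at the first node of disagreement -/

/-- The threshold of an intervened node is independent of the propagation. -/
theorem thresholds_real_propagate_insert_eq_inter (M : BGLM V) (S : Finset V) (θ : M.Weights)
    (ε : V → ℝ) (X : V) (x : V → Bool) (I : Set ℝ) :
    (thresholds V).real {γ | M.propagate (insert X S) θ ε γ = x ∧ γ X ∈ I} =
      (thresholds V).real {γ | M.propagate (insert X S) θ ε γ = x} *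
        (volume.restrict (Icc (0 : ℝ) 1)).real I := by
  set A := M.box (insert X S) θ ε x with hA
  have hinter : {γ | M.propagate (insert X S) θ ε γ = x ∧ γ X ∈ I} =
      Set.univ.pi (Function.update A X (A X ∩ I)) := by
    ext γ
    have h := Set.ext_iff.1 (M.setOf_propagate_eq (insert X S) θ ε x) γ
    simp only [Set.mem_ofPred_eq, Set.mem_univ_pi] at h ⊢
    rw [h, Function.forall_update_iff A (fun Z s => γ Z ∈ s)]
    refine ⟨fun h => ⟨⟨h.1 X, h.2⟩, fun Z _ => h.1 Z⟩, fun h => ⟨fun Z => ?_, h.1.2⟩⟩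
    by_cases hZ : Z = X
    · subst hZ; exact h.1.1
    · exact h.2 Z hZ
  -- As `X` is intervened, the constraint at `X` does not involve its threshold.
  have hAX : A X = Set.univ ∨ A X = ∅ := by
    cases h : x X <;> simp [hA, box, h]
  have hmul : (volume.restrict (Icc (0 : ℝ) 1)).real (A X ∩ I) =
      (volume.restrict (Icc (0 : ℝ) 1)).real (A X) * (volume.restrict (Icc (0 : ℝ) 1)).real I := by
    rcases hAX with h | h <;> simp [h]
  rw [hinter, setOf_propagate_eq, thresholds_real_pi, thresholds_real_pi,
    ← Finset.mul_prod_erase _ _ (Finset.mem_univ X),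
    ← Finset.mul_prod_erase (a := X) (f := fun Z => (volume.restrict (Icc (0 : ℝ) 1)).real
      (M.box (insert X S) θ ε x Z)) _ (Finset.mem_univ X), Function.update_self, hmul,
    Finset.prod_congr rfl fun Z hZ => by rw [Function.update_of_ne (Finset.ne_of_mem_erase hZ)]]
  ring

/-- The end points need not lie in `[0, 1]`: restriction only lowers the measure. -/
theorem real_uIoc_le (a b : ℝ) :
    (volume.restrict (Icc (0 : ℝ) 1)).real (uIoc a b) ≤ |a - b| := by
  calc (volume.restrict (Icc (0 : ℝ) 1)).real (uIoc a b)
      ≤ (volume : Measure ℝ).real (uIoc a b) :=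
        ENNReal.toReal_mono (by simp) (Measure.restrict_apply_le _ _)
    _ = |a - b| := by simp [Measure.real, abs_sub_comm]

/-- The probability that the threshold at `X` separates two functions of its parents' activations
is at most the expected distance of these functions. -/
theorem thresholds_real_mem_uIoc_le (M : BGLM V) (S : Finset V) (θ : M.Weights) (ε : V → ℝ)
    (X : V) (a b : (V → Bool) → ℝ) :
    (thresholds V).real {γ | γ X ∈ uIoc (a (M.propagate (insert X S) θ ε γ))
        (b (M.propagate (insert X S) θ ε γ))} ≤
      ∫ γ, |a (M.propagate (insert X S) θ ε γ) - b (M.propagate (insert X S) θ ε γ)|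
        ∂thresholds V := by
  rw [M.integral_comp_propagate (insert X S) θ ε fun x => |a x - b x|]
  have hsub : {γ | γ X ∈ uIoc (a (M.propagate (insert X S) θ ε γ))
      (b (M.propagate (insert X S) θ ε γ))} ⊆ ⋃ x ∈ (Finset.univ : Finset (V → Bool)),
        {γ | M.propagate (insert X S) θ ε γ = x ∧ γ X ∈ uIoc (a x) (b x)} := by
    intro γ hγ
    simpa using hγ
  refine (measureReal_mono hsub (measure_ne_top _ _)).trans ((measureReal_biUnion_finset_le _ _).trans ?_)
  refine Finset.sum_le_sum fun x _ => ?_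
  rw [thresholds_real_propagate_insert_eq_inter]
  exact mul_le_mul_of_nonneg_left (real_uIoc_le _ _) measureReal_nonneg

/-- If the propagations under two weight vectors differ at `Y`, then at some node on a path to `Y`
the threshold lies between the two activation probabilities. -/
theorem exists_mem_uIoc_of_propagate_ne (M : BGLM V) (S : Finset V) (θ₁ θ₂ : M.Weights)
    (ε γ : V → ℝ) (h : M.propagate S θ₁ ε γ M.Y ≠ M.propagate S θ₂ ε γ M.Y) :
    ∃ X ∈ M.pathNodes (insert M.X₁ S),
      γ X ∈ uIoc (M.prob θ₁ ε (M.propagate (insert X S) θ₂ ε γ) X)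
        (M.prob θ₂ ε (M.propagate (insert X S) θ₂ ε γ) X) := by
  obtain ⟨X, hXY, hne, hpa⟩ := M.exists_first_ne h
  have h1 := M.propagate_iff S θ₁ ε γ X
  have h2 := M.propagate_iff S θ₂ ε γ X
  have hins : ∀ Z, M.edge Z X → M.propagate (insert X S) θ₂ ε γ Z = M.propagate S θ₂ ε γ Z :=
    fun Z hZ => M.propagate_insert_of_edge S θ₂ ε γ hZ
  rw [M.prob_congr θ₁ ε hpa] at h1
  have hXS : X ∉ S := fun hX => hne (by rw [h1.2 (.inl hX), h2.2 (.inl hX)])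
  have hX1 : X ≠ M.X₁ := fun hX => hne (by rw [h1.2 (.inr (.inl hX)), h2.2 (.inr (.inl hX))])
  refine ⟨X, M.mem_pathNodes_of_reflTransGen hXS hX1 hXY, ?_⟩
  -- The interval is half-open because activation means `γ X ≤ prob`: the threshold is at most one
  -- probability and exceeds the other.
  rw [M.prob_congr θ₁ ε hins, M.prob_congr θ₂ ε hins, mem_uIoc]
  simp only [hXS, hX1, false_or] at h1 h2
  rw [Ne, Bool.eq_iff_iff, h1, h2] at hne
  by_contra hcon
  push Not at hcon
  refine hne ⟨fun h => ?_, fun h => ?_⟩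
  · by_contra h'
    exact absurd h (not_le.2 (hcon.2 (not_le.1 h')))
  · by_contra h'
    exact absurd h (not_le.2 (hcon.1 (not_le.1 h')))

/-- The coupling bound for a fixed noise; it holds for every `ε`, as the noise constraint serves
only to identify `σ`. -/
theorem abs_integral_sub_le (M : BGLM V) {L : V → ℝ}
    (hf : ∀ X, X ≠ M.X₁ → ∀ t ∈ Set.Icc (0 : ℝ) ((M.Pa X).card : ℝ),
      DifferentiableAt ℝ (M.f X) t ∧ deriv (M.f X) t ≤ L X)
    (S : Finset V) {θ₁ θ₂ : M.Weights} (hθ₁ : θ₁ ∈ M.Θ) (hθ₂ : θ₂ ∈ M.Θ) (ε : V → ℝ) :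
    |∫ γ, (if M.propagate S θ₁ ε γ M.Y then (1 : ℝ) else 0) ∂thresholds V -
        ∫ γ, (if M.propagate S θ₂ ε γ M.Y then (1 : ℝ) else 0) ∂thresholds V| ≤
      ∫ γ, ∑ X ∈ M.pathNodes (insert M.X₁ S),
        |M.parentVec (M.propagate S θ₂ ε γ) X ⬝ᵥ (θ₁ X - θ₂ X)| * L X ∂thresholds V := by
  have hmeas : ∀ θ : M.Weights, MeasurableSet {γ | M.propagate S θ ε γ M.Y = true} := fun θ =>
    (measurable_pi_iff.1 (M.measurable_propagate_right S θ ε) M.Y) (measurableSet_singleton true)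
  have hind : ∀ θ : M.Weights,
      ∫ γ, (if M.propagate S θ ε γ M.Y then (1 : ℝ) else 0) ∂thresholds V =
        (thresholds V).real {γ | M.propagate S θ ε γ M.Y = true} := fun θ => by
    rw [← integral_indicator_one (hmeas θ)]
    simp only [Set.indicator_apply, Set.mem_ofPred_eq, Pi.one_apply]
  have hint : ∀ (T : Finset V) (h : (V → Bool) → ℝ),
      Integrable (fun γ => h (M.propagate T θ₂ ε γ)) (thresholds V) := fun T h => by
    have hm := M.measurable_propagate_right T θ₂ ε
    have := Measure.isProbabilityMeasure_map (μ := thresholds V) hm.aemeasurable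
    exact (Integrable.of_finite (f := h)).comp_measurable hm
  rw [hind, hind, integral_finsetSum _ fun X _ =>
    hint S fun x => |M.parentVec x X ⬝ᵥ (θ₁ X - θ₂ X)| * L X]
  have hsub : symmDiff {γ | M.propagate S θ₁ ε γ M.Y = true}
      {γ | M.propagate S θ₂ ε γ M.Y = true} ⊆ ⋃ X ∈ M.pathNodes (insert M.X₁ S),
        {γ | γ X ∈ uIoc (M.prob θ₁ ε (M.propagate (insert X S) θ₂ ε γ) X)
          (M.prob θ₂ ε (M.propagate (insert X S) θ₂ ε γ) X)} := by
    intro γ hγ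
    have hne : M.propagate S θ₁ ε γ M.Y ≠ M.propagate S θ₂ ε γ M.Y := fun h => by
      simp [Set.mem_symmDiff, h] at hγ
    simpa using M.exists_mem_uIoc_of_propagate_ne S θ₁ θ₂ ε γ hne
  refine (abs_measureReal_sub_le_measureReal_symmDiff (hmeas θ₁).nullMeasurableSet
    (hmeas θ₂).nullMeasurableSet).trans ((measureReal_mono hsub (measure_ne_top _ _)).trans
      ((measureReal_biUnion_finset_le _ _).trans (Finset.sum_le_sum fun X hX => ?_)))
  have hX1 : X ≠ M.X₁ := fun h =>
    M.not_mem_of_mem_pathNodes hX (h ▸ Finset.mem_insert_self _ _)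
  refine (M.thresholds_real_mem_uIoc_le S θ₂ ε X (fun x => M.prob θ₁ ε x X)
    (fun x => M.prob θ₂ ε x X)).trans (integral_mono
      (hint (insert X S) fun x => |M.prob θ₁ ε x X - M.prob θ₂ ε x X|)
      (hint S fun x => |M.parentVec x X ⬝ᵥ (θ₁ X - θ₂ X)| * L X) fun γ => ?_)
  -- Undoes the auxiliary intervention on `X`, which its parents do not see.
  have hpa : M.parentVec (M.propagate S θ₂ ε γ) X =
      M.parentVec (M.propagate (insert X S) θ₂ ε γ) X :=
    M.parentVec_congr fun Z hZ => (M.propagate_insert_of_edge S θ₂ ε γ hZ).symm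
  simp only [hpa]
  exact M.abs_prob_sub_le hX1 (hf X hX1) hθ₁ hθ₂ ε _

end BGLM

theorem mainTheorem6 {V : Type*} [Fintype V] [DecidableEq V] (M : BGLM V) (L : V → ℝ)
    (hf : ∀ X, X ≠ M.X₁ → ∀ t ∈ Set.Icc (0 : ℝ) ((M.Pa X).card : ℝ),
      DifferentiableAt ℝ (M.f X) t ∧ deriv (M.f X) t ≤ L X)
    (S : Finset V) (hS : M.Y ∉ S)
    (θ₁ θ₂ : M.Weights) (hθ₁ : θ₁ ∈ M.Θ) (hθ₂ : θ₂ ∈ M.Θ) :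
    |M.σ S θ₁ - M.σ S θ₂| ≤
      ∫ p : (V → ℝ) × (V → ℝ),
        ∑ X ∈ M.pathNodes (insert M.X₁ S),
          |M.parentVec (M.propagate S θ₂ p.1 p.2) X ⬝ᵥ (θ₁ X - θ₂ X)| * L X
        ∂(M.noise.prod (BGLM.thresholds V)) := by
  rw [M.σ_eq_integral_propagate S hθ₁, M.σ_eq_integral_propagate S hθ₂]
  have hY : ∀ θ : M.Weights, Integrable (fun ε =>
      ∫ γ, (if M.propagate S θ ε γ M.Y then (1 : ℝ) else 0) ∂BGLM.thresholds V) M.noise :=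
    fun θ => (M.integrable_comp_propagate S θ fun x => if x M.Y then 1 else 0).integral_prod_left
  have hR := M.integrable_comp_propagate S θ₂ fun x =>
    ∑ X ∈ M.pathNodes (insert M.X₁ S), |M.parentVec x X ⬝ᵥ (θ₁ X - θ₂ X)| * L X
  rw [integral_prod _ hR, ← integral_sub (hY θ₁) (hY θ₂)]
  refine abs_integral_le_integral_abs.trans (integral_mono ((hY θ₁).sub (hY θ₂)).abs
    hR.integral_prod_left fun ε => M.abs_integral_sub_le hf S hθ₁ hθ₂ ε)
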